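/- Let $\mathbb N=\{1,2,3,\dots\}$ and $[m]=\{1,\dots,m\}$. Given car lengths $\mathbf y=(y_1,\dots,y_n)\in\mathbb N^n$, put $m=y_1+\cdots+y_n$ and consider a one-way street with parking spots $1,\dots,m$. Given preferences $\mathbf x=(x_1,\dots,x_n)\in[m]^n$, cars $1,\dots,n$ arrive in this order, and car $i$ parks in the spots $t,t+1,\dots,t+y_i-1$, where $t\ge x_i$ is the smallest spot such that these spots all lie on the street and are all unoccupied; if there is no such $t$, parking fails. If all cars are able to park, $\mathbf x$ is a *parking assortment* for $\mathbf y$; it is *invariant* if moreover every rearrangement of $\mathbf x$ is a parking assortment for $\mathbf y$. Let $\mathsf{PA}^{\mathrm{inv},\uparrow}_n(\mathbf y)$ be the set of invariant parking assortments $\mathbf x$ for $\mathbf y$ with $x_1\le x_2\le\cdots\le x_n$. **Theorem.** Let $a<b<c$ be in $\mathbb N$. Then the set $\mathsf{PA}^{\mathrm{inv},\uparrow}_3(\mathbf y)$ is as follows. 1. $\mathbf y=(a,a,a)$: $\{(1,1,1),(1,1,1+a),(1,1,1+2a),(1,1+a,1+a),(1,1+a,1+2a)\}$. 2. $\mathbf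 y=(a,a,b)$: $\{(1,1,1),(1,1,1+a)\}$. 3. $\mathbf y=(a,b,a)$, $b=2a$: $\{(1,1,1),(1,1,1+a),(1,1,1+2a)\}$. 4. $\mathbf y=(a,b,a)$, $b\ne 2a$: $\{(1,1,1),(1,1,1+a)\}$. 5. $\mathbf y=(b,a,a)$, $2a\le b$: $\{(1,1,1),(1,1,1+a),(1,1,1+2a),(1,1+a,1+a),(1,1+a,1+2a)\}$. 6. $\mathbf y=(b,a,a)$, $2a>b$: $\{(1,1,1),(1,1,1+a),(1,1+a,1+a)\}$. 7. $\mathbf y=(a,b,b)$: $\{(1,1,1)\}$. 8. $\mathbf y=(b,a,b)$: $\{(1,1,1),(1,1,1+a)\}$. 9. $\mathbf y=(b,b,a)$: $\{(1,1,1),(1,1,1+a),(1,1,1+b),(1,1,1+a+b)\}$. 10. $\mathbf y=(a,b,c)$: $\{(1,1,1)\}$. 11. $\mathbf y=(a,c,b)$, $a+b=c$: $\{(1,1,1),(1,1,1+a+b)\}$. 12. $\mathbf y=(a,c,b)$, $a+b\ne c$: $\{(1,1,1)\}$. 13. $\mathbf y=(b,a,c)$: $\{(1,1,1),(1,1,1+a)\}$.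 14. $\mathbf y=(b,c,a)$, $a+b=c$: $\{(1,1,1),(1,1,1+a),(1,1,1+a+b)\}$. 15. $\mathbf y=(b,c,a)$, $a+b\ne c$: $\{(1,1,1),(1,1,1+a)\}$. 16. $\mathbf y=(c,a,b)$, $a+b\le c$: $\{(1,1,1),(1,1,1+a),(1,1,1+a+b)\}$. 17. $\mathbf y=(c,a,b)$, $a+b>c$: $\{(1,1,1),(1,1,1+a)\}$. 18. $\mathbf y=(c,b,a)$, $a+b\le c$: $\{(1,1,1),(1,1,1+a),(1,1,1+b),(1,1,1+a+b)\}$. 19. $\mathbf y=(c,b,a)$, $a+b>c$: $\{(1,1,1),(1,1,1+a),(1,1,1+b)\}$. Moreover, the list is exhaustive: for every $\mathbf y\in\mathbb N^3$ there are $a<b<c$ in $\mathbb N$ such that $\mathbf y$ is one of the triples $(a,a,a)$, $(a,a,b)$, $(a,b,a)$, $(b,a,a)$, $(a,b,b)$, $(b,a,b)$, $(b,b,a)$, $(a,b,c)$, $(a,c,b)$, $(b,a,c)$, $(b,c,a)$, $(c,a,b)$, $(c,b,a)$ above. -/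

import Mathlib

/-- The parking experiment on a one-way street with spots `1, …, ∑ i, y i`. The cars `0, 1, …, n - 1`
arrive in this order; car `i` has length `y i` and preference `x i`. `IsOutcome y x s` says that every
car is able to park and that car `i` occupies the spots `s i, …, s i + y i - 1`: its starting spot
`s i` is the first spot `t ≥ x i` such that the spots `t, …, t + y i - 1` all lie on the street and
none of them is occupied by a car that arrived earlier. -/
def IsOutcome {n : ℕ} (y x s : Fin n → ℕ) : Prop :=
  ∀ i : Fin n, IsLeast
    {t : ℕ | x i ≤ t ∧ t + y i ≤ (∑ k, y k) + 1 ∧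
      ∀ j : Fin n, j < i → Disjoint (Set.Ico t (t + y i)) (Set.Ico (s j) (s j + y j))}
    (s i)

/-- The set of parking assortments for the car lengths `y`: the preference lists in `[m]ⁿ`,
where `m = ∑ i, y i`, under which every car is able to park. -/
def parkingAssortments {n : ℕ} (y : Fin n → ℕ) : Set (Fin n → ℕ) :=
  {x | (∀ i, 1 ≤ x i ∧ x i ≤ ∑ k, y k) ∧ ∃ s : Fin n → ℕ, IsOutcome y x s}

/-- The set of (permutation) invariant parking assortments for `y`: the parking assortments all of
whose rearrangements are parking assortments. -/
def invParkingAssortments {n : ℕ} (y : Fin n → ℕ) : Set (Fin n → ℕ) :=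
  {x | x ∈ parkingAssortments y ∧ ∀ σ : Equiv.Perm (Fin n), x ∘ σ ∈ parkingAssortments y}

/-- The set of nondecreasing invariant parking assortments for `y`. -/
def incInvParkingAssortments {n : ℕ} (y : Fin n → ℕ) : Set (Fin n → ℕ) :=
  {x | x ∈ invParkingAssortments y ∧ Monotone x}

/-! The car lengths add up to the street length, so parked cars leave no gap and the order of the
cars along the street determines every starting spot. Each of the six orders then translates into
linear conditions on the preferences (`exists_isOutcome_three_iff`). Imposing these for all six
rearrangements of a nondecreasing list gives one description valid for all lengths
(`threeCarsPark_perms_iff`). Each case of the theorem is a specialisation of it, settled by linear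
arithmetic. -/

/-- The condition on the preferences `x, y, z` for cars of lengths `A, B, C` to be able to park; the
alternatives list the possible orders of the cars along the street. -/
def ThreeCarsPark (A B C x y z : ℕ) : Prop :=
  (x = 1 ∧ y ≤ 1 + A ∧ z ≤ 1 + A + B) ∨
  (x = 1 ∧ y = 1 + A + C ∧ z ≤ 1 + A) ∨
  (x = 1 + B ∧ y = 1 ∧ z ≤ 1 + A + B) ∨
  (x = 1 + B + C ∧ y = 1 ∧ z ≤ 1 + B) ∨
  -- The strict inequality says that car 2, starting at `y` or later, does not fit into the gap of
  -- length `C` in front of car 1; otherwise it would park there.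
  (x = 1 + C ∧ y ≤ 1 + A + C ∧ 1 + C < y + B ∧ z = 1) ∨
  (x = 1 + B + C ∧ y = 1 + C ∧ z = 1)

/-- Lengths being positive, no interval is empty, so disjointness means that one car lies entirely
before the other. This puts the parking rule in a form `omega` can use. -/
theorem isOutcome_three_iff {A B C x y z s t u : ℕ} (hA : 0 < A) (hB : 0 < B) (hC : 0 < C) :
    IsOutcome ![A, B, C] ![x, y, z] ![s, t, u] ↔
      ((x ≤ s ∧ s + A ≤ A + B + C + 1) ∧ ∀ v, x ≤ v → v + A ≤ A + B + C + 1 → s ≤ v) ∧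
      ((y ≤ t ∧ t + B ≤ A + B + C + 1 ∧ (s + A ≤ t ∨ t + B ≤ s)) ∧
        ∀ v, y ≤ v → v + B ≤ A + B + C + 1 → (s + A ≤ v ∨ v + B ≤ s) → t ≤ v) ∧
      ((z ≤ u ∧ u + C ≤ A + B + C + 1 ∧ (s + A ≤ u ∨ u + C ≤ s) ∧ (t + B ≤ u ∨ u + C ≤ t)) ∧
        ∀ v, z ≤ v → v + C ≤ A + B + C + 1 → (s + A ≤ v ∨ v + C ≤ s) →
          (t + B ≤ v ∨ v + C ≤ t) → u ≤ v) := by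
  simp [IsOutcome, Fin.forall_fin_succ, IsLeast, mem_lowerBounds, Fin.sum_univ_three,
    and_assoc, hA.ne', hB.ne', hC.ne']

theorem exists_isOutcome_three_iff {A B C x y z : ℕ} (hA : 0 < A) (hB : 0 < B) (hC : 0 < C)
    (hx : 1 ≤ x) (hy : 1 ≤ y) (hz : 1 ≤ z) :
    (∃ s, IsOutcome ![A, B, C] ![x, y, z] s) ↔ ThreeCarsPark A B C x y z := by
  constructor
  · rintro ⟨f, hf⟩
    have e : f = ![f 0, f 1, f 2] := by ext i; fin_cases i <;> rfl
    rw [e, isOutcome_three_iff hA hB hC] at hf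
    generalize f 0 = s at hf
    generalize f 1 = t at hf
    generalize f 2 = u at hf
    obtain ⟨⟨hs, hs'⟩, ⟨ht, ht'⟩, hu, -⟩ := hf
    obtain rfl : s = x := le_antisymm (hs' x le_rfl (by omega)) hs.1
    -- Car 2 starts either at its preference or right behind car 1, so minimality is needed only at
    -- these two spots. Car 3 gets the only gap left.
    have h1 := ht' y le_rfl
    have h2 := ht' (s + A)
    clear hs' ht'
    obtain ⟨ht1, ht2, ht3⟩ := ht
    obtain ⟨hu1, hu2, hu3, hu4⟩ := hu
    unfold ThreeCarsPark
    -- Eight sign patterns of pairwise precedence: two are cyclic, hence impossible, and the other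
    -- six are the orders of the cars.
    rcases ht3 with ht3 | ht3 <;> rcases hu3 with hu3 | hu3 <;> rcases hu4 with hu4 | hu4
    · left; omega
    · right; left; omega
    · omega
    · right; right; right; right; left; omega
    · right; right; left; omega
    · omega
    · right; right; right; left; omega
    · right; right; right; right; right; omega
  · rintro (h | h | h | h | h | h)
    · refine ⟨![1, 1 + A, 1 + A + B], (isOutcome_three_iff hA hB hC).2 ?_⟩
      refine ⟨⟨?_, fun v => ?_⟩, ⟨?_, fun v => ?_⟩, ?_, fun v => ?_⟩ <;> omega
    · refine ⟨![1, 1 + A + C, 1 + A], (isOutcome_three_iff hA hB hC).2 ?_⟩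
      refine ⟨⟨?_, fun v => ?_⟩, ⟨?_, fun v => ?_⟩, ?_, fun v => ?_⟩ <;> omega
    · refine ⟨![1 + B, 1, 1 + A + B], (isOutcome_three_iff hA hB hC).2 ?_⟩
      refine ⟨⟨?_, fun v => ?_⟩, ⟨?_, fun v => ?_⟩, ?_, fun v => ?_⟩ <;> omega
    · refine ⟨![1 + B + C, 1, 1 + B], (isOutcome_three_iff hA hB hC).2 ?_⟩
      refine ⟨⟨?_, fun v => ?_⟩, ⟨?_, fun v => ?_⟩, ?_, fun v => ?_⟩ <;> omega
    · refine ⟨![1 + C, 1 + A + C, 1], (isOutcome_three_iff hA hB hC).2 ?_⟩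
      refine ⟨⟨?_, fun v => ?_⟩, ⟨?_, fun v => ?_⟩, ?_, fun v => ?_⟩ <;> omega
    · refine ⟨![1 + B + C, 1 + C, 1], (isOutcome_three_iff hA hB hC).2 ?_⟩
      refine ⟨⟨?_, fun v => ?_⟩, ⟨?_, fun v => ?_⟩, ?_, fun v => ?_⟩ <;> omega

theorem mem_parkingAssortments_three_iff {A B C x y z : ℕ} (hA : 0 < A) (hB : 0 < B)
    (hC : 0 < C) :
    ![x, y, z] ∈ parkingAssortments ![A, B, C] ↔
      (1 ≤ x ∧ 1 ≤ y ∧ 1 ≤ z) ∧ ThreeCarsPark A B C x y z := by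
  have hmem : ![x, y, z] ∈ parkingAssortments ![A, B, C] ↔
      ((1 ≤ x ∧ x ≤ A + B + C) ∧ (1 ≤ y ∧ y ≤ A + B + C) ∧ (1 ≤ z ∧ z ≤ A + B + C)) ∧
        ∃ s, IsOutcome ![A, B, C] ![x, y, z] s := by
    simp [parkingAssortments, Fin.forall_fin_succ, Fin.sum_univ_three]
  rw [hmem]
  constructor
  · rintro ⟨⟨⟨hx, -⟩, ⟨hy, -⟩, hz, -⟩, h⟩
    exact ⟨⟨hx, hy, hz⟩, (exists_isOutcome_three_iff hA hB hC hx hy hz).1 h⟩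
  · rintro ⟨⟨hx, hy, hz⟩, h⟩
    refine ⟨?_, (exists_isOutcome_three_iff hA hB hC hx hy hz).2 h⟩
    unfold ThreeCarsPark at h
    omega

theorem forall_perm_fin_three_iff {α : Type*} {P : (Fin 3 → α) → Prop} {x y z : α} :
    (∀ σ : Equiv.Perm (Fin 3), P (![x, y, z] ∘ σ)) ↔
      P ![x, y, z] ∧ P ![x, z, y] ∧ P ![y, x, z] ∧ P ![y, z, x] ∧ P ![z, x, y] ∧ P ![z, y, x] := by
  have comp_eq (σ : Equiv.Perm (Fin 3)) : ![x, y, z] ∘ σ =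
      ![![x, y, z] (σ 0), ![x, y, z] (σ 1), ![x, y, z] (σ 2)] := by
    ext i
    fin_cases i <;> rfl
  simp only [comp_eq]
  constructor
  · intro h
    exact ⟨h 1, h (Equiv.swap 1 2), h (Equiv.swap 0 1), h (finRotate 3),
      h (finRotate 3)⁻¹, h (Equiv.swap 0 2)⟩
  · rintro ⟨h1, h2, h3, h4, h5, h6⟩ σ
    have h01 : σ 0 ≠ σ 1 := by simp
    have h02 : σ 0 ≠ σ 2 := by simp
    have h12 : σ 1 ≠ σ 2 := by simp
    generalize σ 0 = i at *
    generalize σ 1 = j at *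
    generalize σ 2 = k at *
    fin_cases i <;> fin_cases j <;> fin_cases k <;> first | contradiction | assumption

/-- Some car starts at spot 1 and must prefer it, so the least preference is 1. The two alternatives
for `y` are `y = 1` and `y > 1`; in the latter only one car prefers spot 1, which is so rigid that
it forces `B = C`. -/
theorem threeCarsPark_perms_iff {A B C x y z : ℕ} (hA : 0 < A) (hB : 0 < B) (hC : 0 < C) :
    ((1 ≤ x ∧ x ≤ y ∧ y ≤ z) ∧ ThreeCarsPark A B C x y z ∧ ThreeCarsPark A B C x z y ∧
        ThreeCarsPark A B C y x z ∧ ThreeCarsPark A B C y z x ∧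
        ThreeCarsPark A B C z x y ∧ ThreeCarsPark A B C z y x) ↔
      x = 1 ∧ ((y = 1 ∧ 1 ≤ z ∧ z ≤ 1 + A + B ∧ (z ≤ 1 + A ∨ z = 1 + A + C) ∧
          (z = 1 ∨ z = 1 + B ∨ z = 1 + B + C ∨ z = 1 + C ∧ C < B)) ∨
        (y = 1 + B ∧ C = B ∧ B ≤ A ∧ (z = 1 + B ∨ z = 1 + 2 * B ∧ (2 * B ≤ A ∨ A = B)))) := by
  constructor
  · rintro ⟨hle, h1, h2, h3, h4, h5, h6⟩
    obtain rfl : x = 1 := by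
      clear h2 h3 h4 h5 h6
      unfold ThreeCarsPark at h1
      omega
    refine ⟨rfl, ?_⟩
    unfold ThreeCarsPark at *
    rcases hle.2.1.eq_or_lt with rfl | hy
    -- With two preferences equal to 1 only three rearrangements differ. `h1`, for `(1, 1, z)`,
    -- gives `z ≤ 1 + A + B`; `h4`, for `(1, z, 1)`, and `h5`, for `(z, 1, 1)`, give the two
    -- disjunctions.
    · clear h2 h3 h6
      left
      refine ⟨rfl, ?_, ?_, ?_, ?_⟩ <;> omega
    · right
      replace h1 : y ≤ 1 + A ∧ z ≤ 1 + A + B := by omega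
      replace h3 : y = 1 + B := by omega
      -- This value comes from the arrangement `(y, z, 1)` in `h4`; the values of `z` below then
      -- come from `(z, y, 1)` in `h6`. The final bounds on `A` use `(1, y, z)` and `(1, z, y)`.
      replace h5 : y = 1 + C := by omega
      replace h4 : z = 1 + B ∨ z = 1 + B + C := by omega
      omega
  · rintro ⟨rfl, ⟨rfl, h⟩ | ⟨rfl, rfl, h⟩⟩
    · unfold ThreeCarsPark
      refine ⟨?_, ?_, ?_, ?_, ?_, ?_, ?_⟩ <;> omega
    · unfold ThreeCarsPark
      refine ⟨?_, ?_, ?_, ?_, ?_, ?_, ?_⟩ <;> omega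

theorem mem_incInvParkingAssortments_three_iff {A B C x y z : ℕ} (hA : 0 < A) (hB : 0 < B)
    (hC : 0 < C) :
    ![x, y, z] ∈ incInvParkingAssortments ![A, B, C] ↔
      x = 1 ∧ ((y = 1 ∧ 1 ≤ z ∧ z ≤ 1 + A + B ∧ (z ≤ 1 + A ∨ z = 1 + A + C) ∧
          (z = 1 ∨ z = 1 + B ∨ z = 1 + B + C ∨ z = 1 + C ∧ C < B)) ∨
        (y = 1 + B ∧ C = B ∧ B ≤ A ∧ (z = 1 + B ∨ z = 1 + 2 * B ∧ (2 * B ≤ A ∨ A = B)))) := by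
  have hmono : Monotone ![x, y, z] ↔ x ≤ y ∧ y ≤ z := by
    simp [Fin.monotone_iff_le_succ, Fin.forall_fin_succ]
  rw [← threeCarsPark_perms_iff hA hB hC]
  simp only [incInvParkingAssortments, invParkingAssortments, Set.mem_ofPred_eq, hmono,
    forall_perm_fin_three_iff (P := (· ∈ parkingAssortments ![A, B, C])),
    mem_parkingAssortments_three_iff hA hB hC]
  constructor
  · tauto
  · rintro ⟨⟨hx, hxy, hyz⟩, h⟩
    have hy := hx.trans hxy
    have hz := hy.trans hyz
    tauto

theorem incInvParkingAssortments_three_eq {A B C : ℕ} {S : Set (Fin 3 → ℕ)} (hA : 0 < A)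
    (hB : 0 < B) (hC : 0 < C)
    (h : ∀ x y z, (x = 1 ∧ ((y = 1 ∧ 1 ≤ z ∧ z ≤ 1 + A + B ∧ (z ≤ 1 + A ∨ z = 1 + A + C) ∧
          (z = 1 ∨ z = 1 + B ∨ z = 1 + B + C ∨ z = 1 + C ∧ C < B)) ∨
        (y = 1 + B ∧ C = B ∧ B ≤ A ∧ (z = 1 + B ∨ z = 1 + 2 * B ∧ (2 * B ≤ A ∨ A = B))))) ↔
      ![x, y, z] ∈ S) :
    incInvParkingAssortments ![A, B, C] = S := by
  ext f
  have e : f = ![f 0, f 1, f 2] := by ext i; fin_cases i <;> rfl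
  rw [e, mem_incInvParkingAssortments_three_iff hA hB hC, h]

theorem vec_three_eq_iff {x y z u v w : ℕ} :
    ![x, y, z] = ![u, v, w] ↔ x = u ∧ y = v ∧ z = w := by
  simp

theorem mainTheorem5 :
    (∀ a b c : ℕ, 0 < a → a < b → b < c →
      (incInvParkingAssortments ![a, a, a] =
        {![1, 1, 1], ![1, 1, 1 + a], ![1, 1, 1 + 2 * a], ![1, 1 + a, 1 + a],
          ![1, 1 + a, 1 + 2 * a]}) ∧
      (incInvParkingAssortments ![a, a, b] = {![1, 1, 1], ![1, 1, 1 + a]}) ∧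
      (b = 2 * a → incInvParkingAssortments ![a, b, a] =
        {![1, 1, 1], ![1, 1, 1 + a], ![1, 1, 1 + 2 * a]}) ∧
      (b ≠ 2 * a → incInvParkingAssortments ![a, b, a] = {![1, 1, 1], ![1, 1, 1 + a]}) ∧
      (2 * a ≤ b → incInvParkingAssortments ![b, a, a] =
        {![1, 1, 1], ![1, 1, 1 + a], ![1, 1, 1 + 2 * a], ![1, 1 + a, 1 + a],
          ![1, 1 + a, 1 + 2 * a]}) ∧
      (2 * a > b → incInvParkingAssortments ![b, a, a] =
        {![1, 1, 1], ![1, 1, 1 + a], ![1, 1 + a, 1 + a]}) ∧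
      (incInvParkingAssortments ![a, b, b] = {![1, 1, 1]}) ∧
      (incInvParkingAssortments ![b, a, b] = {![1, 1, 1], ![1, 1, 1 + a]}) ∧
      (incInvParkingAssortments ![b, b, a] =
        {![1, 1, 1], ![1, 1, 1 + a], ![1, 1, 1 + b], ![1, 1, 1 + a + b]}) ∧
      (incInvParkingAssortments ![a, b, c] = {![1, 1, 1]}) ∧
      (a + b = c → incInvParkingAssortments ![a, c, b] = {![1, 1, 1], ![1, 1, 1 + a + b]}) ∧
      (a + b ≠ c → incInvParkingAssortments ![a, c, b] = {![1, 1, 1]}) ∧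
      (incInvParkingAssortments ![b, a, c] = {![1, 1, 1], ![1, 1, 1 + a]}) ∧
      (a + b = c → incInvParkingAssortments ![b, c, a] =
        {![1, 1, 1], ![1, 1, 1 + a], ![1, 1, 1 + a + b]}) ∧
      (a + b ≠ c → incInvParkingAssortments ![b, c, a] = {![1, 1, 1], ![1, 1, 1 + a]}) ∧
      (a + b ≤ c → incInvParkingAssortments ![c, a, b] =
        {![1, 1, 1], ![1, 1, 1 + a], ![1, 1, 1 + a + b]}) ∧
      (a + b > c → incInvParkingAssortments ![c, a, b] = {![1, 1, 1], ![1, 1, 1 + a]}) ∧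
      (a + b ≤ c → incInvParkingAssortments ![c, b, a] =
        {![1, 1, 1], ![1, 1, 1 + a], ![1, 1, 1 + b], ![1, 1, 1 + a + b]}) ∧
      (a + b > c → incInvParkingAssortments ![c, b, a] =
        {![1, 1, 1], ![1, 1, 1 + a], ![1, 1, 1 + b]})) ∧
    (∀ y : Fin 3 → ℕ, (∀ i, 0 < y i) → ∃ a b c : ℕ, 0 < a ∧ a < b ∧ b < c ∧
      y ∈ ({![a, a, a], ![a, a, b], ![a, b, a], ![b, a, a], ![a, b, b], ![b, a, b], ![b, b, a],
        ![a, b, c], ![a, c, b], ![b, a, c], ![b, c, a], ![c, a, b], ![c, b, a]} :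
          Set (Fin 3 → ℕ))) := by
  refine ⟨fun a b c ha hab hbc => ?_, fun y hy => ?_⟩
  · refine ⟨?_, ?_, fun h => ?_, fun h => ?_, fun h => ?_, fun h => ?_, ?_, ?_, ?_, ?_, fun h => ?_,
      fun h => ?_, ?_, fun h => ?_, fun h => ?_, fun h => ?_, fun h => ?_, fun h => ?_,
      fun h => ?_⟩ <;>
    · refine incInvParkingAssortments_three_eq (by omega) (by omega) (by omega) fun x y z => ?_
      simp only [Set.mem_insert_iff, Set.mem_singleton_iff, vec_three_eq_iff, true_and, and_true,
        or_true]
      constructor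
      · rintro ⟨rfl, h⟩
        omega
      · intro h
        omega
  · obtain ⟨p, q, r, rfl⟩ : ∃ p q r, y = ![p, q, r] :=
      ⟨y 0, y 1, y 2, by ext i; fin_cases i <;> rfl⟩
    have hp : 0 < p := hy 0
    have hq : 0 < q := hy 1
    have hr : 0 < r := hy 2
    rcases lt_trichotomy p q with h1 | rfl | h1
    · rcases lt_trichotomy q r with h2 | rfl | h2
      · exact ⟨p, q, r, hp, by omega, by omega, by simp⟩
      -- When lengths coincide, the unused values among `a, b, c` are arbitrary subject to `a < b <
      -- c`.
      · exact ⟨p, q, q + 1, hp, by omega, by omega, by simp⟩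
      · rcases lt_trichotomy p r with h3 | rfl | h3
        · exact ⟨p, r, q, hp, by omega, by omega, by simp⟩
        · exact ⟨p, q, q + 1, hp, by omega, by omega, by simp⟩
        · exact ⟨r, p, q, hr, by omega, by omega, by simp⟩
    · rcases lt_trichotomy p r with h2 | rfl | h2
      · exact ⟨p, r, r + 1, hp, by omega, by omega, by simp⟩
      · exact ⟨p, p + 1, p + 2, hp, by omega, by omega, by simp⟩
      · exact ⟨r, p, p + 1, hr, by omega, by omega, by simp⟩
    · rcases lt_trichotomy q r with h2 | rfl | h2
      · rcases lt_trichotomy p r with h3 | rfl | h3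
        · exact ⟨q, p, r, hq, by omega, by omega, by simp⟩
        · exact ⟨q, p, p + 1, hq, by omega, by omega, by simp⟩
        · exact ⟨q, r, p, hq, by omega, by omega, by simp⟩
      · exact ⟨q, p, p + 1, hq, by omega, by omega, by simp⟩
      · exact ⟨r, q, p, hr, by omega, by omega, by simp⟩
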